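/- Let $m\ge 5$ be an odd integer, put $v=2^m-1$, and let $\mathcal C$ be a binary linear code of length $v$ (a subspace of $\mathrm{GF}(2)^v$) with coordinates indexed by $\mathcal P=\{0,1,\dots,v-1\}$. For $w\ge 0$ let $A_w$ be the number of codewords of $\mathcal C$ of Hamming weight $w$, and assume that $$A_0=1,$$ $$A_{2^{m-1}-2^{(m+1)/2}}=a:=(2^m-1)\,2^{(m-5)/2}\,(2^{(m-3)/2}+1)(2^{m-1}-1)/3,$$ $$A_{2^{m-1}-2^{(m-1)/2}}=b:=(2^m-1)\,2^{(m-3)/2}\,(2^{(m-1)/2}+1)(5\cdot 2^{m-1}+4)/3,$$ $$A_{2^{m-1}}=c:=(2^m-1)(9\cdot 2^{2m-4}+3\cdot 2^{m-3}+1),$$ $$A_{2^{m-1}+2^{(m-1)/2}}=d:=(2^m-1)\,2^{(m-3)/2}\,(2^{(m-1)/2}-1)(5\cdot 2^{m-1}+4)/3,$$ $$A_{2^{m-1}+2^{(m+1)/2}}=e:=(2^m-1)\,2^{(m-5)/2}\,(2^{(m-3)/2}-1)(2^{m-1}-1)/3,$$ and $A_w=0$ for every other $w$. Let $\mathcal C^\perp$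 be the dual code with respect to the standard dot product, and let $A_k^\perp$ be the number of its codewords of Hamming weight $k$. The support of a word is the set of its nonzero coordinates. A (simple) $t$-$(v,k,\lambda)$ design, where $1\le t\le k\le v$, is a set $\mathcal P$ of $v$ points with a set $\mathcal B$ of $k$-subsets of $\mathcal P$ such that every $t$-subset of $\mathcal P$ is contained in exactly $\lambda$ elements of $\mathcal B$. 1. For every $k\ge 1$ with $A_k\ne 0$ one has $2<k<v$, and the set of supports of the codewords of weight $k$ of $\mathcal C$ is the block set of a $2$-$(2^m-1,k,\lambda)$ design on $\mathcal P$ with $$\lambda=\frac{k(k-1)A_k}{(2^m-1)(2^m-2)}.$$ 2. For every $k\ge 1$ with $A_k^\perp\ne 0$ one has $k>2$, and the set of supports of the codewords of weight $k$ of $\mathcal C^\perp$ is the block set of a $2$-$(2^m-1,k,\lambda)$ design on $\mathcal P$ with $$\lambda=\frac{k(k-1)A_k^\perp}{(2^m-1)(2^m-2)}.$$ 3. Here, for $0\le k\le 2^m-1$, $A_k^\perp$ is given by $$2^{3m}A_k^\perp=\binom{2^m-1}{k}+a\,U_{2^{m-1}-2^{(m+1)/2}}(k)+b\,U_{2^{m-1}-2^{(m-1)/2}}(k)+c\,U_{2^{m-1}}(k)+d\,U_{2^{m-1}+2^{(m-1)/2}}(k)+e\,U_{2^{m-1}+2^{(m+1)/2}}(k),$$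 where $$U_w(k)=\sum_{\substack{0\le i\le w,\ 0\le j\le 2^m-1-w\\ i+j=k}}(-1)^i\binom{w}{i}\binom{2^m-1-w}{j}.$$ -/

import Mathlib

/-- `(P, B)` is a (simple) `t`-`(v, k, lam)` design: `P` has `v` points, every block is a
`k`-subset of `P`, `1 ≤ t ≤ k ≤ v`, and every `t`-subset of `P` lies in exactly `lam` blocks. -/
structure IsTDesign {P : Type*} [Fintype P] (t v k lam : ℕ) (B : Set (Finset P)) : Prop where
  card_points : Fintype.card P = v
  one_le_t : 1 ≤ t
  t_le_k : t ≤ k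
  k_le_v : k ≤ v
  card_block : ∀ b ∈ B, b.card = k
  balanced : ∀ T : Finset P, T.card = t → {b | b ∈ B ∧ T ⊆ b}.ncard = lam

/-- A binary linear code of length `n`; the coordinates are indexed by `0, …, n - 1`. -/
abbrev BinaryCode (n : ℕ) : Type := Submodule (ZMod 2) (Fin n → ZMod 2)

namespace BinaryCode

variable {n : ℕ}

/-- The dual code, with respect to the standard dot product. -/
def dual (C : BinaryCode n) : BinaryCode n where
  carrier := {x | ∀ c ∈ C, x ⬝ᵥ c = 0}
  add_mem' := by
    intro x y hx hy c hc
    rw [add_dotProduct, hx c hc, hy c hc, add_zero]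
  zero_mem' := by
    intro c _
    exact zero_dotProduct c
  smul_mem' := by
    intro r x hx c hc
    rw [smul_dotProduct, hx c hc, smul_zero]

/-- The number of codewords of Hamming weight `w`. -/
noncomputable def weightCount (C : BinaryCode n) (w : ℕ) : ℕ :=
  {c : Fin n → ZMod 2 | c ∈ C ∧ hammingNorm c = w}.ncard

/-- The support of a word: the set of its nonzero coordinates. -/
def support (c : Fin n → ZMod 2) : Finset (Fin n) :=
  Finset.univ.filter fun i => c i ≠ 0

/-- The set of the supports of the codewords of Hamming weight `k`. -/
def supports (C : BinaryCode n) (k : ℕ) : Set (Finset (Fin n)) :=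
  {b | ∃ c ∈ C, hammingNorm c = k ∧ support c = b}

end BinaryCode

namespace FiveWeight

/-! The five nonzero weights and their frequencies, for odd `m ≥ 5`. In this range every
subtraction and division of exponents below is exact. -/

def wA (m : ℕ) : ℕ := 2 ^ (m - 1) - 2 ^ ((m + 1) / 2)
def wB (m : ℕ) : ℕ := 2 ^ (m - 1) - 2 ^ ((m - 1) / 2)
def wC (m : ℕ) : ℕ := 2 ^ (m - 1)
def wD (m : ℕ) : ℕ := 2 ^ (m - 1) + 2 ^ ((m - 1) / 2)
def wE (m : ℕ) : ℕ := 2 ^ (m - 1) + 2 ^ ((m + 1) / 2)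

def a (m : ℕ) : ℚ :=
  (2 ^ m - 1) * 2 ^ ((m - 5) / 2) * (2 ^ ((m - 3) / 2) + 1) * (2 ^ (m - 1) - 1) / 3
def b (m : ℕ) : ℚ :=
  (2 ^ m - 1) * 2 ^ ((m - 3) / 2) * (2 ^ ((m - 1) / 2) + 1) * (5 * 2 ^ (m - 1) + 4) / 3
def c (m : ℕ) : ℚ :=
  (2 ^ m - 1) * (9 * 2 ^ (2 * m - 4) + 3 * 2 ^ (m - 3) + 1)
def d (m : ℕ) : ℚ :=
  (2 ^ m - 1) * 2 ^ ((m - 3) / 2) * (2 ^ ((m - 1) / 2) - 1) * (5 * 2 ^ (m - 1) + 4) / 3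
def e (m : ℕ) : ℚ :=
  (2 ^ m - 1) * 2 ^ ((m - 5) / 2) * (2 ^ ((m - 3) / 2) - 1) * (2 ^ (m - 1) - 1) / 3

/-- The prescribed number of codewords of weight `w`. -/
def tableCount (m w : ℕ) : ℚ :=
  if w = 0 then 1
  else if w = wA m then a m
  else if w = wB m then b m
  else if w = wC m then c m
  else if w = wD m then d m
  else if w = wE m then e m
  else 0

/-- `∑ (-1)^i * binom(w, i) * binom(n - w, j)` over `i + j = k` (so `j = k - i`); terms with `i > w` or
`j > n - w` vanish. -/
def U (n w k : ℕ) : ℚ :=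
  ∑ i ∈ Finset.range (k + 1), (-1) ^ i * (w.choose i : ℚ) * ((n - w).choose (k - i) : ℚ)

/-- The explicit number of words of weight `k` in the dual code. -/
def dualCount (m k : ℕ) : ℚ :=
  (((2 ^ m - 1).choose k : ℚ) + a m * U (2 ^ m - 1) (wA m) k + b m * U (2 ^ m - 1) (wB m) k
    + c m * U (2 ^ m - 1) (wC m) k + d m * U (2 ^ m - 1) (wD m) k
    + e m * U (2 ^ m - 1) (wE m) k) / 2 ^ (3 * m)

end FiveWeight

/-! This is the Assmus–Mattson argument with five nonzero weights and dual minimum distance at least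
7, so that 7 - 5 = 2. The MacWilliams identity (`sum_U_words`) computes the dual distribution from
the table, and the explicit values make it vanish for weights 1 to 6 (`dualCount_eq_zero`).

Let `u` have weight at most 2. For `j ≤ 4` the sum over `C` of `chi u` times the Krawtchouk number
`U n w j` only sees words `y` of weight `j` with `u + y` in the dual; as `u + y` has weight at most
6, this forces `y = u`. So these five moments depend only on the weight of `u`. They determine all
polynomial moments of degree at most 4, hence by interpolation at the five weights the moment of any
function of the weight (`sum_mul_chi_eq`). Fourier expansion in two coordinates then shows that pair
counts do not depend on the pair (`sum_pair_eq`).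

For the dual code, MacWilliams twisted by translations of weight at most 2 turns its pair counts
into sums over `C` of the same kind (`dual_pairCount_eq`). Double counting gives the value of `lam`
(`exists_isTDesign`). -/

/-! ### Krawtchouk numbers -/

open Polynomial in
theorem coeff_one_sub_X_pow (w k : ℕ) :
    ((1 - X : ℚ[X]) ^ w).coeff k = (-1) ^ k * (w.choose k : ℚ) := by
  have h : (1 - X : ℚ[X]) ^ w = ((1 + X : ℚ[X]) ^ w).comp (C (-1) * X) := by
    simp [sub_eq_add_neg]
  rw [h, comp_C_mul_X_coeff, coeff_one_add_X_pow, mul_comm]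

namespace FiveWeight

open Polynomial in
/-- `U n w k` is a coefficient of the generating function of the Krawtchouk numbers. -/
theorem U_eq_coeff (n w k : ℕ) :
    U n w k = (((1 - X) ^ w * (1 + X) ^ (n - w) : ℚ[X])).coeff k := by
  rw [coeff_mul, Finset.Nat.sum_antidiagonal_eq_sum_range_succ
    (fun i j => ((1 - X : ℚ[X]) ^ w).coeff i * ((1 + X : ℚ[X]) ^ (n - w)).coeff j)]
  simp [U, coeff_one_sub_X_pow, coeff_one_add_X_pow]

theorem U_zero_left (n k : ℕ) : U n 0 k = n.choose k := by
  rw [U_eq_coeff]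
  simp [Polynomial.coeff_one_add_X_pow]

theorem U_zero_right (n w : ℕ) : U n w 0 = 1 := by
  simp [U]

theorem U_one_right {n w : ℕ} (h : w ≤ n) : U n w 1 = n - 2 * w := by
  simp [U, Finset.sum_range_succ, Nat.cast_sub h]
  ring

-- The generating function `F = (1 - X)^w (1 + X)^(n - w)` satisfies `(1 - X²) F' = ((n - 2w) - nX)
-- F`; compare coefficients.
open Polynomial in
theorem U_recurrence {n w : ℕ} (h : w ≤ n) (k : ℕ) :
    ((k : ℚ) + 2) * U n w (k + 2) = (n - 2 * w) * U n w (k + 1) - (n - k) * U n w k := by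
  have hd1 (r : ℕ) : (1 - X : ℚ[X]) * derivative ((1 - X) ^ r) = -(r : ℚ[X]) * (1 - X) ^ r := by
    cases r with
    | zero => simp
    | succ r => rw [derivative_pow]; simp; ring
  have hd2 (r : ℕ) : (1 + X : ℚ[X]) * derivative ((1 + X) ^ r) = (r : ℚ[X]) * (1 + X) ^ r := by
    cases r with
    | zero => simp
    | succ r => rw [derivative_pow]; simp; ring
  set F : ℚ[X] := (1 - X) ^ w * (1 + X) ^ (n - w) with hF
  have hode : derivative F - X * (X * derivative F)
      = C ((n : ℚ) - 2 * w) * F - X * (C (n : ℚ) * F) := by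
    have e : ((n - w : ℕ) : ℚ[X]) = (n : ℚ[X]) - w := by rw [Nat.cast_sub h]
    have h1 := hd1 w
    have h2 := hd2 (n - w)
    rw [e] at h2
    have hC : C ((n : ℚ) - 2 * w) = (n : ℚ[X]) - 2 * w := by
      rw [map_sub, map_mul, map_ofNat, map_natCast, map_natCast]
    have hC' : C (n : ℚ) = (n : ℚ[X]) := by simp
    rw [hC, hC', hF, derivative_mul]
    linear_combination (1 + X) * (1 + X) ^ (n - w) * h1 + (1 - X) * (1 - X) ^ w * h2
  have hk := congrArg (fun p => p.coeff (k + 1)) hode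
  simp only [coeff_sub, coeff_X_mul, coeff_C_mul, coeff_derivative] at hk
  simp only [U_eq_coeff, ← hF]
  cases k with
  | zero =>
    simp at hk ⊢
    linarith
  | succ k =>
    simp only [coeff_X_mul, coeff_derivative] at hk
    push_cast at hk ⊢
    linarith

/-- Cases 2 to 4 convert Krawtchouk moments into power moments in `n - 2w`; cases 5 and 6 are needed
only for the dual minimum distance. -/
theorem U_two {n w : ℕ} (h : w ≤ n) :
    2 * U n w 2 = ((n : ℚ) - 2 * w) ^ 2 - n := by
  have := U_recurrence h 0
  rw [U_zero_right, zero_add, U_one_right h] at this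
  push_cast at this
  linear_combination this

theorem U_three {n w : ℕ} (h : w ≤ n) :
    6 * U n w 3 = ((n : ℚ) - 2 * w) ^ 3 - (3 * n - 2) * (n - 2 * w) := by
  have := U_recurrence h 1
  rw [U_one_right h] at this
  push_cast at this
  linear_combination 2 * this + ((n : ℚ) - 2 * w) * U_two h

theorem U_four {n w : ℕ} (h : w ≤ n) :
    24 * U n w 4 = ((n : ℚ) - 2 * w) ^ 4 - (6 * n - 8) * (n - 2 * w) ^ 2 + 3 * n * (n - 2) := by
  have := U_recurrence h 2
  push_cast at this
  linear_combination 6 * this + ((n : ℚ) - 2 * w) * U_three h - 3 * ((n : ℚ) - 2) * U_two h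

theorem U_five {n w : ℕ} (h : w ≤ n) :
    120 * U n w 5 = ((n : ℚ) - 2 * w) * (((n : ℚ) - 2 * w) ^ 4 - (6 * n - 8) * (n - 2 * w) ^ 2
      + 3 * n * (n - 2)) - 4 * (n - 3) * (((n : ℚ) - 2 * w) ^ 3 - (3 * n - 2) * (n - 2 * w)) := by
  have := U_recurrence h 3
  push_cast at this
  linear_combination 24 * this + ((n : ℚ) - 2 * w) * U_four h - 4 * ((n : ℚ) - 3) * U_three h

theorem U_six {n w : ℕ} (h : w ≤ n) :
    720 * U n w 6 = ((n : ℚ) - 2 * w) * (((n : ℚ) - 2 * w) * (((n : ℚ) - 2 * w) ^ 4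
      - (6 * n - 8) * (n - 2 * w) ^ 2 + 3 * n * (n - 2))
      - 4 * (n - 3) * (((n : ℚ) - 2 * w) ^ 3 - (3 * n - 2) * (n - 2 * w)))
      - 5 * (n - 4) * (((n : ℚ) - 2 * w) ^ 4 - (6 * n - 8) * (n - 2 * w) ^ 2 + 3 * n * (n - 2)) := by
  have := U_recurrence h 4
  push_cast at this
  linear_combination 120 * this + ((n : ℚ) - 2 * w) * U_five h - 5 * ((n : ℚ) - 4) * U_four h

end FiveWeight

/-! ### Characters and the MacWilliams identity -/

namespace BinaryCode

/-- The nontrivial character of `ZMod 2`. -/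
def sign (t : ZMod 2) : ℚ := if t = 0 then 1 else -1

theorem sign_add (s t : ZMod 2) : sign (s + t) = sign s * sign t := by
  revert s t
  decide +kernel

/-- The character of `GF(2)^n` attached to the word `x`. -/
def chi {n : ℕ} (x y : Fin n → ZMod 2) : ℚ := ∏ i, sign (x i * y i)

theorem chi_comm {n : ℕ} (x y : Fin n → ZMod 2) : chi x y = chi y x := by
  simp [chi, mul_comm]

theorem chi_add_left {n : ℕ} (x x' y : Fin n → ZMod 2) :
    chi (x + x') y = chi x y * chi x' y := by
  simp [chi, add_mul, sign_add, Finset.prod_mul_distrib]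

theorem chi_add_right {n : ℕ} (x y y' : Fin n → ZMod 2) :
    chi x (y + y') = chi x y * chi x y' := by
  rw [chi_comm, chi_add_left, chi_comm y, chi_comm y']

theorem chi_zero_left {n : ℕ} (y : Fin n → ZMod 2) : chi 0 y = 1 := by
  simp [chi, sign]

theorem chi_zero_right {n : ℕ} (y : Fin n → ZMod 2) : chi y 0 = 1 := by
  simp [chi, sign]

theorem chi_eq_sign_dotProduct {n : ℕ} (x y : Fin n → ZMod 2) : chi x y = sign (x ⬝ᵥ y) := by
  have h (s : Finset (Fin n)) : ∏ i ∈ s, sign (x i * y i) = sign (∑ i ∈ s, x i * y i) := by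
    induction s using Finset.cons_induction with
    | empty => simp [sign]
    | cons i s hi ih => rw [Finset.prod_cons, Finset.sum_cons, sign_add, ih]
  exact h _

theorem chi_single_left {n : ℕ} (i : Fin n) (y : Fin n → ZMod 2) :
    chi (Pi.single i 1) y = sign (y i) := by
  rw [chi_eq_sign_dotProduct, single_dotProduct, one_mul]

open Polynomial in
/-- The character sum over a Hamming sphere is a Krawtchouk number. -/
theorem sum_chi_sphere {n : ℕ} (x : Fin n → ZMod 2) (k : ℕ) :
    ∑ y : Fin n → ZMod 2 with hammingNorm y = k, chi x y = FiveWeight.U n (hammingNorm x) k := by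
  -- Character and weight are both multiplicative over coordinates, so the sum over `y` is a product
  -- of factors `1 + X` (where `x i = 0`) and `1 - X` (elsewhere).
  have hgen : ∑ y : Fin n → ZMod 2, C (chi x y) * X ^ hammingNorm y
      = ((1 - X) ^ hammingNorm x * (1 + X) ^ (n - hammingNorm x) : ℚ[X]) := by
    have h1 (y : Fin n → ZMod 2) : C (chi x y) * X ^ hammingNorm y
        = ∏ i, (C (sign (x i * y i)) * if y i = 0 then 1 else X : ℚ[X]) := by
      rw [Finset.prod_mul_distrib, chi, map_prod, hammingNorm, Finset.prod_ite]
      simp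
    have h2 (t : ZMod 2) : ∑ u : ZMod 2, (C (sign (t * u)) * if u = 0 then 1 else X : ℚ[X])
        = if t = 0 then 1 + X else 1 - X := by
      have h01 : t = 0 ∨ t = 1 := by revert t; decide
      have hu : (Finset.univ : Finset (ZMod 2)) = {0, 1} := by decide
      rw [hu, Finset.sum_pair zero_ne_one]
      rcases h01 with rfl | rfl <;> simp [sign, sub_eq_add_neg]
    simp_rw [h1]
    have h3 := Finset.prod_univ_sum (fun _ : Fin n => (Finset.univ : Finset (ZMod 2)))
      (fun i u => (C (sign (x i * u)) * if u = 0 then 1 else X : ℚ[X]))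
    rw [Fintype.piFinset_univ] at h3
    rw [← h3]
    simp_rw [h2]
    have hc : (Finset.univ.filter fun i => x i = 0).card = n - hammingNorm x := by
      have := Finset.card_filter_add_card_filter_not (s := Finset.univ) (fun i => x i = 0)
      rw [Finset.card_univ, Fintype.card_fin] at this
      simp only [hammingNorm, ne_eq]
      omega
    rw [Finset.prod_ite, Finset.prod_const, Finset.prod_const, hc, mul_comm]
    rfl
  rw [FiveWeight.U_eq_coeff, ← hgen, finsetSum_coeff, Finset.sum_filter]
  refine Finset.sum_congr rfl fun y _ => ?_
  rw [coeff_C_mul, coeff_X_pow]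
  simp [eq_comm]

open Classical in
/-- The codewords of a code, as a finite set. -/
noncomputable def words {n : ℕ} (C : BinaryCode n) : Finset (Fin n → ZMod 2) :=
  Finset.univ.filter (· ∈ C)

theorem mem_words {n : ℕ} {C : BinaryCode n} {c : Fin n → ZMod 2} : c ∈ C.words ↔ c ∈ C := by
  simp [words]

theorem weightCount_eq_card {n : ℕ} (C : BinaryCode n) (w : ℕ) :
    C.weightCount w = (C.words.filter fun c => hammingNorm c = w).card := by
  rw [weightCount, ← Set.ncard_coe_finset]
  congr 1
  ext c
  simp [mem_words]

-- If `x` is not in the dual, some `c₀` in `C` has `chi x c₀ = -1`, and translating by `c₀` negates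
-- the sum.
open Classical in
theorem sum_chi_words {n : ℕ} (C : BinaryCode n) (x : Fin n → ZMod 2) :
    ∑ c ∈ C.words, chi x c = if x ∈ C.dual then (C.words.card : ℚ) else 0 := by
  split_ifs with hx
  · rw [Finset.sum_congr rfl (g := fun _ => (1 : ℚ))]
    · simp
    · intro c hc
      rw [chi_eq_sign_dotProduct, hx c (mem_words.1 hc), sign, if_pos rfl]
  · obtain ⟨c₀, hc₀, hne⟩ : ∃ c₀ ∈ C, x ⬝ᵥ c₀ ≠ 0 := by
      by_contra! h
      exact hx h
    have hs : ∑ c ∈ C.words, chi x (c + c₀) = ∑ c ∈ C.words, chi x c := by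
      refine Finset.sum_bij' (fun c _ => c + c₀) (fun c _ => c - c₀) ?_ ?_ ?_ ?_ ?_
      · intro c hc
        exact mem_words.2 (C.add_mem (mem_words.1 hc) hc₀)
      · intro c hc
        exact mem_words.2 (C.sub_mem (mem_words.1 hc) hc₀)
      · simp
      · simp
      · simp
    have hm : chi x c₀ = -1 := by
      rw [chi_eq_sign_dotProduct, sign, if_neg hne]
    simp_rw [chi_add_right, hm] at hs
    rw [← Finset.sum_mul] at hs
    linarith

open Classical in
/-- The MacWilliams identity, twisted by a translation. -/
theorem sum_U_translate {n : ℕ} (C : BinaryCode n) (u : Fin n → ZMod 2) (k : ℕ) :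
    ∑ c ∈ C.words, FiveWeight.U n (hammingNorm (c + u)) k
      = C.words.card * ∑ y ∈ C.dual.words with hammingNorm y = k, chi u y := by
  -- After expanding `U` over a sphere and swapping the sums, the sum over `c` selects the `y` in
  -- the dual and `chi u y` remains.
  simp_rw [← sum_chi_sphere, chi_add_left]
  rw [Finset.sum_comm]
  simp_rw [← Finset.sum_mul, chi_comm _, sum_chi_words]
  rw [Finset.mul_sum]
  simp_rw [ite_mul, zero_mul]
  rw [← Finset.sum_filter, Finset.filter_filter]
  refine Finset.sum_congr ?_ fun y _ => by rw [chi_comm]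
  ext y
  simp [mem_words, and_comm]

theorem sum_U_words {n : ℕ} (C : BinaryCode n) (k : ℕ) :
    ∑ c ∈ C.words, FiveWeight.U n (hammingNorm c) k
      = C.words.card * C.dual.weightCount k := by
  have h := sum_U_translate C 0 k
  simp only [add_zero, chi_zero_left] at h
  rw [h, weightCount_eq_card]
  simp

end BinaryCode

/-! ### Pair counts are independent of the pair -/

namespace BinaryCode

theorem hammingNorm_le_length {n : ℕ} (c : Fin n → ZMod 2) : hammingNorm c ≤ n := by
  simpa using hammingNorm_le_card_fintype (x := c)

theorem hammingNorm_add_le {n : ℕ} (x y : Fin n → ZMod 2) :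
    hammingNorm (x + y) ≤ hammingNorm x + hammingNorm y := by
  unfold hammingNorm
  refine (Finset.card_le_card fun i hi => ?_).trans (Finset.card_union_le _ _)
  simp only [Finset.mem_filter, Finset.mem_univ, true_and, Finset.mem_union, Pi.add_apply] at hi ⊢
  by_contra! h
  exact hi (by simp [h.1, h.2])

theorem hammingNorm_single {n : ℕ} (i : Fin n) :
    hammingNorm (Pi.single i 1 : Fin n → ZMod 2) = 1 := by
  rw [hammingNorm, Finset.card_eq_one]
  refine ⟨i, ?_⟩
  ext j
  by_cases h : j = i <;> simp [h]

theorem hammingNorm_add_single {n : ℕ} (c : Fin n → ZMod 2) (i : Fin n) :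
    hammingNorm (c + Pi.single i 1)
      = if c i = 0 then hammingNorm c + 1 else hammingNorm c - 1 := by
  have h01 : c i = 0 ∨ c i = 1 := by
    generalize c i = t
    revert t
    decide
  unfold hammingNorm
  split_ifs with h
  · rw [← Finset.card_insert_of_notMem (a := i) (by simp [h])]
    congr 1
    ext j
    by_cases hj : j = i
    · subst hj; simp [h]
    · simp [hj]
  · have h1 := h01.resolve_left h
    rw [← Finset.card_erase_of_mem (a := i) (by simp [h])]
    congr 1
    ext j
    by_cases hj : j = i
    · subst hj; simp [h1]; exact CharTwo.add_self_eq_zero 1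
    · simp [hj]

/-- Krawtchouk moments of a code whose dual has large minimum distance, twisted by a character. -/
theorem sum_chi_mul_U {n d : ℕ} (C : BinaryCode n)
    (hd : ∀ y ∈ C.dual, y ≠ 0 → d ≤ hammingNorm y) {u : Fin n → ZMod 2} {j : ℕ}
    (hu : hammingNorm u + j < d) :
    ∑ c ∈ C.words, chi u c * FiveWeight.U n (hammingNorm c) j
      = if hammingNorm u = j then (C.words.card : ℚ) else 0 := by
  classical
  simp_rw [← sum_chi_sphere, Finset.mul_sum]
  rw [Finset.sum_comm]
  have hs (y : Fin n → ZMod 2) (hy : hammingNorm y = j) :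
      ∑ c ∈ C.words, chi u c * chi y c = if u = y then (C.words.card : ℚ) else 0 := by
    simp_rw [← chi_add_left, sum_chi_words]
    -- A dual word `u + y` has weight below `d`, so it is zero, which in characteristic 2 means `u =
    -- y`.
    refine if_congr ⟨fun h => ?_, fun h => ?_⟩ rfl rfl
    · by_contra hne
      have h0 : u + y ≠ 0 := by
        intro h0
        apply hne
        rw [eq_neg_of_add_eq_zero_left h0]
        funext i
        exact CharTwo.neg_eq _
      have := hd _ h h0
      have := hammingNorm_add_le u y
      omega
    · subst h
      have : u + u = 0 := by
        funext i
        exact CharTwo.add_self_eq_zero _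
      rw [this]
      exact C.dual.zero_mem
  rw [Finset.sum_congr rfl (g := fun y => if u = y then (C.words.card : ℚ) else 0)]
  · rw [Finset.sum_ite_eq]
    simp
  · intro y hy
    rw [← hs y (by simpa using hy)]
    exact Finset.sum_congr rfl fun c _ => by rw [chi_comm c y]

open Polynomial in
/-- The weighted character sums over a code depend only on the weight of the character. -/
theorem sum_mul_chi_eq {n : ℕ} (C : BinaryCode n) (S : Finset ℕ) (hS : S.card ≤ 5)
    (hCS : ∀ c ∈ C, c ≠ 0 → hammingNorm c ∈ S)
    (hd : ∀ y ∈ C.dual, y ≠ 0 → 7 ≤ hammingNorm y) {u u' : Fin n → ZMod 2}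
    (huu : hammingNorm u = hammingNorm u') (hu : hammingNorm u ≤ 2) (φ : ℕ → ℚ) :
    ∑ c ∈ C.words, φ (hammingNorm c) * chi u c = ∑ c ∈ C.words, φ (hammingNorm c) * chi u' c := by
  let g : (Fin n → ZMod 2) → ℚ := fun c => chi u c - chi u' c
  let z : ℕ → ℚ := fun w => n - 2 * w
  have hK (j : ℕ) (hj : j ≤ 4) :
      ∑ c ∈ C.words, g c * FiveWeight.U n (hammingNorm c) j = 0 := by
    simp only [g, sub_mul, Finset.sum_sub_distrib]
    rw [sum_chi_mul_U C hd (by omega), sum_chi_mul_U C hd (by omega), huu, sub_self]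
  have hle (c : Fin n → ZMod 2) : hammingNorm c ≤ n := hammingNorm_le_length c
  -- `U n w j` has degree `j` in `n - 2w`, so the vanishing passes successively to the power
  -- moments.
  have m0 : ∑ c ∈ C.words, g c = 0 := by
    simpa [FiveWeight.U_zero_right] using hK 0 (by norm_num)
  have m1 : ∑ c ∈ C.words, g c * z (hammingNorm c) = 0 := by
    rw [← hK 1 (by norm_num)]
    simp_rw [FiveWeight.U_one_right (hle _)]
    rfl
  have m2 : ∑ c ∈ C.words, g c * z (hammingNorm c) ^ 2 = 0 := by
    have e (c : Fin n → ZMod 2) : g c * z (hammingNorm c) ^ 2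
        = 2 * (g c * FiveWeight.U n (hammingNorm c) 2) + n * g c := by
      linear_combination (-g c) * FiveWeight.U_two (hle c)
    simp_rw [e, Finset.sum_add_distrib, ← Finset.mul_sum, hK 2 (by norm_num), m0]
    simp
  have m3 : ∑ c ∈ C.words, g c * z (hammingNorm c) ^ 3 = 0 := by
    have e (c : Fin n → ZMod 2) : g c * z (hammingNorm c) ^ 3
        = 6 * (g c * FiveWeight.U n (hammingNorm c) 3)
          + (3 * n - 2) * (g c * z (hammingNorm c)) := by
      linear_combination (-g c) * FiveWeight.U_three (hle c)
    simp_rw [e, Finset.sum_add_distrib, ← Finset.mul_sum, hK 3 (by norm_num), m1]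
    simp
  have m4 : ∑ c ∈ C.words, g c * z (hammingNorm c) ^ 4 = 0 := by
    have e (c : Fin n → ZMod 2) : g c * z (hammingNorm c) ^ 4
        = 24 * (g c * FiveWeight.U n (hammingNorm c) 4)
          + (6 * n - 8) * (g c * z (hammingNorm c) ^ 2) + (- (3 * n * (n - 2))) * g c := by
      linear_combination (-g c) * FiveWeight.U_four (hle c)
    simp_rw [e, Finset.sum_add_distrib, ← Finset.mul_sum, hK 4 (by norm_num), m2, m0]
    simp
  have hz : Set.InjOn z S := by
    intro a _ b _ hab
    have : (a : ℚ) = b := by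
      simp only [z] at hab
      linarith
    exact_mod_cast this
  let p : ℚ[X] := Lagrange.interpolate S z φ
  have hp : p.natDegree < 5 := by
    have h1 : p.degree < S.card := Lagrange.degree_interpolate_lt φ hz
    by_cases h0 : p = 0
    · simp [h0]
    · have := (natDegree_lt_iff_degree_lt h0).2 h1
      omega
  have hpz : ∑ c ∈ C.words, g c * p.eval (z (hammingNorm c)) = 0 := by
    simp_rw [eval_eq_sum_range' hp, Finset.mul_sum]
    rw [Finset.sum_comm]
    refine Finset.sum_eq_zero fun j hj => ?_
    have e (c : Fin n → ZMod 2) : g c * (p.coeff j * z (hammingNorm c) ^ j)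
        = p.coeff j * (g c * z (hammingNorm c) ^ j) := by ring
    simp_rw [e, ← Finset.mul_sum]
    rw [Finset.mem_range] at hj
    interval_cases j <;> simp [m0, m1, m2, m3, m4]
  rw [← sub_eq_zero, ← Finset.sum_sub_distrib, ← hpz]
  refine Finset.sum_congr rfl fun c hc => ?_
  -- The zero word need not be a node: every character is 1 there, so `g 0 = 0`. Hence five nodes
  -- suffice.
  by_cases h0 : c = 0
  · simp [h0, g, chi_zero_right]
  · rw [Lagrange.eval_interpolate_at_node φ hz (hCS c (mem_words.1 hc) h0)]
    simp only [g]
    ring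

/-- Sums over the code of functions of the weight and of two coordinates do not depend on the
choice of the coordinates. -/
theorem sum_pair_eq {n : ℕ} (C : BinaryCode n) (S : Finset ℕ) (hS : S.card ≤ 5)
    (hCS : ∀ c ∈ C, c ≠ 0 → hammingNorm c ∈ S)
    (hd : ∀ y ∈ C.dual, y ≠ 0 → 7 ≤ hammingNorm y) (ψ : ℕ → ZMod 2 → ZMod 2 → ℚ)
    {i j i' j' : Fin n} (hij : i ≠ j) (hij' : i' ≠ j') :
    ∑ c ∈ C.words, ψ (hammingNorm c) (c i) (c j)
      = ∑ c ∈ C.words, ψ (hammingNorm c) (c i') (c j') := by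
  -- Fourier expansion on `GF(2)²`, with the factor 4 cleared.
  have hexp (i j : Fin n) (c : Fin n → ZMod 2) :
      4 * ψ (hammingNorm c) (c i) (c j) =
        (fun w => ψ w 0 0 + ψ w 0 1 + ψ w 1 0 + ψ w 1 1) (hammingNorm c)
        + (fun w => ψ w 0 0 + ψ w 0 1 - ψ w 1 0 - ψ w 1 1) (hammingNorm c)
          * chi (Pi.single i 1) c
        + (fun w => ψ w 0 0 - ψ w 0 1 + ψ w 1 0 - ψ w 1 1) (hammingNorm c)
          * chi (Pi.single j 1) c
        + (fun w => ψ w 0 0 - ψ w 0 1 - ψ w 1 0 + ψ w 1 1) (hammingNorm c)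
          * chi (Pi.single i 1 + Pi.single j 1) c := by
    have h01 : ∀ t : ZMod 2, t = 0 ∨ t = 1 := by decide
    rw [chi_add_left, chi_single_left, chi_single_left]
    rcases h01 (c i) with h | h <;> rcases h01 (c j) with h' | h' <;> rw [h, h'] <;>
      simp [sign] <;> ring
  have h2 {i j : Fin n} (h : i ≠ j) :
      hammingNorm (Pi.single i 1 + Pi.single j 1 : Fin n → ZMod 2) = 2 := by
    rw [hammingNorm_add_single, hammingNorm_single, if_pos (by simp [h.symm])]
  have h4 : 4 * ∑ c ∈ C.words, ψ (hammingNorm c) (c i) (c j)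
      = 4 * ∑ c ∈ C.words, ψ (hammingNorm c) (c i') (c j') := by
    rw [Finset.mul_sum, Finset.mul_sum]
    simp_rw [hexp, Finset.sum_add_distrib]
    have s1 (a b : Fin n) :
        hammingNorm (Pi.single a 1 : Fin n → ZMod 2)
          = hammingNorm (Pi.single b 1 : Fin n → ZMod 2) := by
      rw [hammingNorm_single, hammingNorm_single]
    have l1 (a : Fin n) : hammingNorm (Pi.single a 1 : Fin n → ZMod 2) ≤ 2 := by
      rw [hammingNorm_single]; norm_num
    rw [sum_mul_chi_eq C S hS hCS hd (s1 i i') (l1 i) (fun w => ψ w 0 0 + ψ w 0 1 - ψ w 1 0 - ψ w 1 1),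
      sum_mul_chi_eq C S hS hCS hd (s1 j j') (l1 j) (fun w => ψ w 0 0 - ψ w 0 1 + ψ w 1 0 - ψ w 1 1),
      sum_mul_chi_eq C S hS hCS hd ((h2 hij).trans (h2 hij').symm) (h2 hij).le
        (fun w => ψ w 0 0 - ψ w 0 1 - ψ w 1 0 + ψ w 1 1)]
  linarith

/-- The number of codewords of weight `k` whose support contains `i` and `j`. -/
noncomputable def pairCount {n : ℕ} (C : BinaryCode n) (k : ℕ) (i j : Fin n) : ℕ :=
  (C.words.filter fun c => hammingNorm c = k ∧ c i ≠ 0 ∧ c j ≠ 0).card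

theorem pairCount_eq {n : ℕ} (C : BinaryCode n) (S : Finset ℕ) (hS : S.card ≤ 5)
    (hCS : ∀ c ∈ C, c ≠ 0 → hammingNorm c ∈ S)
    (hd : ∀ y ∈ C.dual, y ≠ 0 → 7 ≤ hammingNorm y) (k : ℕ)
    {i j i' j' : Fin n} (hij : i ≠ j) (hij' : i' ≠ j') :
    C.pairCount k i j = C.pairCount k i' j' := by
  have h := sum_pair_eq C S hS hCS hd
    (fun w s t => if w = k ∧ s ≠ 0 ∧ t ≠ 0 then 1 else 0) hij hij'
  simp only [Finset.sum_boole] at h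
  exact_mod_cast h

/-- Four times the indicator of `y i ≠ 0 ∧ y j ≠ 0` is `(1 - sign (y i)) * (1 - sign (y j))`.
Twisted MacWilliams moves each of the four terms to `C`, where the weight of a translate depends
only on the weight of `c` and on `c i`, `c j`. -/
theorem dual_pairCount_eq {n : ℕ} (C : BinaryCode n) (S : Finset ℕ) (hS : S.card ≤ 5)
    (hCS : ∀ c ∈ C, c ≠ 0 → hammingNorm c ∈ S)
    (hd : ∀ y ∈ C.dual, y ≠ 0 → 7 ≤ hammingNorm y) (k : ℕ)
    {i j i' j' : Fin n} (hij : i ≠ j) (hij' : i' ≠ j') :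
    C.dual.pairCount k i j = C.dual.pairCount k i' j' := by
  let K : ℕ → ℚ := fun w => FiveWeight.U n w k
  -- The weight after flipping a coordinate whose value is `t`.
  let s : ℕ → ZMod 2 → ℕ := fun w t => if t = 0 then w + 1 else w - 1
  have key {i j : Fin n} (hij : i ≠ j) :
      4 * C.words.card * (C.dual.pairCount k i j : ℚ) =
        ∑ c ∈ C.words, (fun w x y => K w - K (s w x) - K (s w y) + K (s (s w x) y))
          (hammingNorm c) (c i) (c j) := by
    have h0 : ∑ c ∈ C.words, K (hammingNorm c)
        = C.words.card * ∑ y ∈ C.dual.words with hammingNorm y = k, 1 := by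
      simpa [chi_zero_left] using sum_U_translate C 0 k
    have h1 (i : Fin n) : ∑ c ∈ C.words, K (s (hammingNorm c) (c i))
        = C.words.card * ∑ y ∈ C.dual.words with hammingNorm y = k, sign (y i) := by
      have := sum_U_translate C (Pi.single i 1) k
      simp_rw [hammingNorm_add_single, chi_single_left] at this
      exact this
    have h2 : ∑ c ∈ C.words, K (s (s (hammingNorm c) (c i)) (c j))
        = C.words.card * ∑ y ∈ C.dual.words with hammingNorm y = k, sign (y i) * sign (y j) := by
      have := sum_U_translate C (Pi.single i 1 + Pi.single j 1) k
      have hj (c : Fin n → ZMod 2) : (c + Pi.single i 1 : Fin n → ZMod 2) j = c j := by simp [hij.symm]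
      simp_rw [← add_assoc, hammingNorm_add_single, hj, chi_add_left, chi_single_left] at this
      exact this
    simp only [Finset.sum_add_distrib, Finset.sum_sub_distrib]
    rw [h0, h1, h1, h2, pairCount, ← Finset.filter_filter, ← Finset.sum_boole,
      ← mul_sub, ← mul_sub, ← mul_add, mul_comm (4 : ℚ), mul_assoc]
    congr 1
    rw [← Finset.sum_sub_distrib, ← Finset.sum_sub_distrib, ← Finset.sum_add_distrib,
      Finset.mul_sum]
    refine Finset.sum_congr rfl fun y _ => ?_
    by_cases hi : y i = 0 <;> by_cases hj : y j = 0 <;> (simp [hi, hj, sign]; try norm_num)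
  have hpos : (C.words.card : ℚ) ≠ 0 := by
    have : 0 < C.words.card := Finset.card_pos.2 ⟨0, mem_words.2 C.zero_mem⟩
    positivity
  have h := (key hij).trans ((sum_pair_eq C S hS hCS hd
    (fun w x y => K w - K (s w x) - K (s w y) + K (s (s w x) y)) hij hij').trans (key hij').symm)
  have h4 : (4 * C.words.card : ℚ) ≠ 0 := by positivity
  exact_mod_cast mul_left_cancel₀ h4 h

/-! ### From pair counts to designs -/

theorem support_injective {n : ℕ} :
    Function.Injective (support : (Fin n → ZMod 2) → Finset (Fin n)) := by
  intro x y h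
  funext i
  have hi : x i ≠ 0 ↔ y i ≠ 0 := by
    have := Finset.ext_iff.1 h i
    simpa [support] using this
  have h2 : ∀ s t : ZMod 2, (s ≠ 0 ↔ t ≠ 0) → s = t := by decide
  exact h2 _ _ hi

theorem ncard_blocks_eq_pairCount {n : ℕ} (C : BinaryCode n) (k : ℕ) (i j : Fin n) :
    {b | b ∈ C.supports k ∧ {i, j} ⊆ b}.ncard = C.pairCount k i j := by
  have h : {b | b ∈ C.supports k ∧ {i, j} ⊆ b} = support ''
      (C.words.filter fun c => hammingNorm c = k ∧ c i ≠ 0 ∧ c j ≠ 0 : Set (Fin n → ZMod 2)) := by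
    ext b
    simp only [supports, Set.mem_ofPred_eq, Set.mem_image, Finset.coe_filter, mem_words]
    constructor
    · rintro ⟨⟨c, hc, hk, rfl⟩, hb⟩
      simp [Finset.insert_subset_iff, support] at hb
      exact ⟨c, ⟨hc, hk, hb⟩, rfl⟩
    · rintro ⟨c, ⟨hc, hk, hb⟩, rfl⟩
      refine ⟨⟨c, hc, hk, rfl⟩, ?_⟩
      simpa [Finset.insert_subset_iff, support] using hb
  rw [h, Set.ncard_image_of_injective _ support_injective, Set.ncard_coe_finset, pairCount]

/-- Counting flags of ordered pairs of points and codewords. -/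
theorem sum_pairCount {n : ℕ} (C : BinaryCode n) (k : ℕ) :
    ∑ p ∈ (Finset.univ : Finset (Fin n)).offDiag, C.pairCount k p.1 p.2
      = C.weightCount k * (k * k - k) := by
  have e (i j : Fin n) : C.pairCount k i j = ∑ c ∈ C.words with hammingNorm c = k,
      if c i ≠ 0 ∧ c j ≠ 0 then 1 else 0 := by
    rw [pairCount, ← Finset.filter_filter, Finset.card_filter]
  simp_rw [e]
  rw [weightCount_eq_card, Finset.sum_comm, ← smul_eq_mul, ← Finset.sum_const]
  refine Finset.sum_congr rfl fun c hc => ?_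
  have hk : (support c).card = k := (Finset.mem_filter.1 hc).2
  rw [← Finset.card_filter, ← hk, ← Finset.offDiag_card]
  congr 1
  ext p
  simp [support]
  tauto

/-- Codewords of a fixed weight support a `2`-design once all pair counts agree. -/
theorem exists_isTDesign {n : ℕ} (C : BinaryCode n) {k : ℕ} (hk : 2 ≤ k) (hkn : k ≤ n)
    (hpair : ∀ i j i' j' : Fin n, i ≠ j → i' ≠ j' → C.pairCount k i j = C.pairCount k i' j') :
    ∃ lam : ℕ, (lam : ℚ) = (k : ℚ) * ((k : ℚ) - 1) * (C.weightCount k : ℚ) /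
        ((n : ℚ) * ((n : ℚ) - 1)) ∧ IsTDesign 2 n k lam (C.supports k) := by
  let i₀ : Fin n := ⟨0, by omega⟩
  let j₀ : Fin n := ⟨1, by omega⟩
  have h₀ : i₀ ≠ j₀ := by simp [i₀, j₀]
  refine ⟨C.pairCount k i₀ j₀, ?_, Fintype.card_fin n, by norm_num, hk, hkn, ?_, ?_⟩
  · have h := sum_pairCount C k
    rw [Finset.sum_congr rfl (g := fun _ => C.pairCount k i₀ j₀)
      (fun p hp => hpair _ _ _ _ (Finset.mem_offDiag.1 hp).2.2 h₀), Finset.sum_const,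
      Finset.offDiag_card, Finset.card_univ, Fintype.card_fin, smul_eq_mul] at h
    have hq := congrArg (Nat.cast : ℕ → ℚ) h
    rw [Nat.cast_mul, Nat.cast_mul, Nat.cast_sub (Nat.le_mul_self n),
      Nat.cast_sub (Nat.le_mul_self k)] at hq
    push_cast at hq
    have hn : (2 : ℚ) ≤ n := by exact_mod_cast hk.trans hkn
    rw [eq_div_iff (by apply mul_ne_zero <;> linarith)]
    linarith
  · rintro b ⟨c, _, hc, rfl⟩
    exact hc
  · intro T hT
    obtain ⟨i, j, hij, rfl⟩ := Finset.card_eq_two.1 hT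
    rw [ncard_blocks_eq_pairCount]
    exact hpair _ _ _ _ hij h₀

end BinaryCode

/-! ### The explicit weight distribution -/

namespace FiveWeight

theorem tableCount_zero (m : ℕ) : tableCount m 0 = 1 := by simp [tableCount]

/-- With `m = 2 * r + 5` all exponent divisions are exact, and the length, weights and frequencies
become polynomials in `2 ^ r`. -/
theorem two_pow_odd (r : ℕ) : 2 ^ (2 * r + 5) = 32 * (2 ^ r) ^ 2 := by ring

theorem wA_eq (r : ℕ) : wA (2 * r + 5) = 16 * (2 ^ r) ^ 2 - 8 * 2 ^ r := by
  have h1 : 2 * r + 5 - 1 = 2 * r + 4 := by omega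
  have h2 : (2 * r + 5 + 1) / 2 = r + 3 := by omega
  rw [wA, h1, h2]
  ring_nf

theorem wB_eq (r : ℕ) : wB (2 * r + 5) = 16 * (2 ^ r) ^ 2 - 4 * 2 ^ r := by
  have h1 : 2 * r + 5 - 1 = 2 * r + 4 := by omega
  have h2 : (2 * r + 4) / 2 = r + 2 := by omega
  rw [wB, h1, h2]
  ring_nf

theorem wC_eq (r : ℕ) : wC (2 * r + 5) = 16 * (2 ^ r) ^ 2 := by
  have h1 : 2 * r + 5 - 1 = 2 * r + 4 := by omega
  rw [wC, h1]
  ring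

theorem wD_eq (r : ℕ) : wD (2 * r + 5) = 16 * (2 ^ r) ^ 2 + 4 * 2 ^ r := by
  have h1 : 2 * r + 5 - 1 = 2 * r + 4 := by omega
  have h2 : (2 * r + 4) / 2 = r + 2 := by omega
  rw [wD, h1, h2]
  ring

theorem wE_eq (r : ℕ) : wE (2 * r + 5) = 16 * (2 ^ r) ^ 2 + 8 * 2 ^ r := by
  have h1 : 2 * r + 5 - 1 = 2 * r + 4 := by omega
  have h2 : (2 * r + 5 + 1) / 2 = r + 3 := by omega
  rw [wE, h1, h2]
  ring

theorem a_eq (r : ℕ) : a (2 * r + 5)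
    = (32 * (2 ^ r) ^ 2 - 1) * 2 ^ r * (2 * 2 ^ r + 1) * (16 * (2 ^ r) ^ 2 - 1) / 3 := by
  have h1 : 2 * r + 5 - 1 = 2 * r + 4 := by omega
  have h2 : (2 * r + 5 - 5) / 2 = r := by omega
  have h3 : (2 * r + 5 - 3) / 2 = r + 1 := by omega
  rw [a, h2, h3, h1]
  ring

theorem b_eq (r : ℕ) : b (2 * r + 5)
    = (32 * (2 ^ r) ^ 2 - 1) * (2 * 2 ^ r) * (4 * 2 ^ r + 1) * (80 * (2 ^ r) ^ 2 + 4) / 3 := by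
  have h1 : 2 * r + 5 - 1 = 2 * r + 4 := by omega
  have h2 : (2 * r + 4) / 2 = r + 2 := by omega
  have h3 : (2 * r + 5 - 3) / 2 = r + 1 := by omega
  rw [b, h3, h1, h2]
  ring

theorem c_eq (r : ℕ) : c (2 * r + 5)
    = (32 * (2 ^ r) ^ 2 - 1) * (576 * (2 ^ r) ^ 4 + 12 * (2 ^ r) ^ 2 + 1) := by
  have h1 : 2 * (2 * r + 5) - 4 = 4 * r + 6 := by omega
  have h2 : 2 * r + 5 - 3 = 2 * r + 2 := by omega
  rw [c, h1, h2]
  ring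

theorem d_eq (r : ℕ) : d (2 * r + 5)
    = (32 * (2 ^ r) ^ 2 - 1) * (2 * 2 ^ r) * (4 * 2 ^ r - 1) * (80 * (2 ^ r) ^ 2 + 4) / 3 := by
  have h1 : 2 * r + 5 - 1 = 2 * r + 4 := by omega
  have h2 : (2 * r + 4) / 2 = r + 2 := by omega
  have h3 : (2 * r + 5 - 3) / 2 = r + 1 := by omega
  rw [d, h3, h1, h2]
  ring

theorem e_eq (r : ℕ) : e (2 * r + 5)
    = (32 * (2 ^ r) ^ 2 - 1) * 2 ^ r * (2 * 2 ^ r - 1) * (16 * (2 ^ r) ^ 2 - 1) / 3 := by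
  have h1 : 2 * r + 5 - 1 = 2 * r + 4 := by omega
  have h2 : (2 * r + 5 - 5) / 2 = r := by omega
  have h3 : (2 * r + 5 - 3) / 2 = r + 1 := by omega
  rw [e, h2, h3, h1]
  ring

/-- The five weights are nonzero, increasing and below the length. -/
theorem weights_chain (r : ℕ) :
    2 < wA (2 * r + 5) ∧ wA (2 * r + 5) < wB (2 * r + 5) ∧ wB (2 * r + 5) < wC (2 * r + 5) ∧
      wC (2 * r + 5) < wD (2 * r + 5) ∧ wD (2 * r + 5) < wE (2 * r + 5) ∧
      wE (2 * r + 5) < 2 ^ (2 * r + 5) - 1 := by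
  rw [wA_eq, wB_eq, wC_eq, wD_eq, wE_eq, two_pow_odd]
  have hs : 1 ≤ 2 ^ r := Nat.one_le_two_pow
  have h2 : 2 ^ r ≤ (2 ^ r) ^ 2 := Nat.le_self_pow (by norm_num) _
  omega

/-- The nonzero weights of the code. -/
def weights (m : ℕ) : Finset ℕ := {wA m, wB m, wC m, wD m, wE m}

theorem card_weights_le (m : ℕ) : (weights m).card ≤ 5 := Finset.card_le_five

theorem mem_weights_of_tableCount_ne_zero {m w : ℕ} (h0 : w ≠ 0) (h : tableCount m w ≠ 0) :
    w ∈ weights m := by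
  by_contra hw
  simp only [weights, Finset.mem_insert, Finset.mem_singleton, not_or] at hw
  apply h
  simp [tableCount, h0, hw]

theorem bounds_of_mem_weights {r w : ℕ} (h : w ∈ weights (2 * r + 5)) :
    2 < w ∧ w < 2 ^ (2 * r + 5) - 1 := by
  have := weights_chain r
  simp only [weights, Finset.mem_insert, Finset.mem_singleton] at h
  omega

theorem sum_tableCount (r : ℕ) (φ : ℕ → ℚ) :
    ∑ w ∈ insert 0 (weights (2 * r + 5)), tableCount (2 * r + 5) w * φ w
      = φ 0 + a (2 * r + 5) * φ (wA (2 * r + 5)) + b (2 * r + 5) * φ (wB (2 * r + 5))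
        + c (2 * r + 5) * φ (wC (2 * r + 5)) + d (2 * r + 5) * φ (wD (2 * r + 5))
        + e (2 * r + 5) * φ (wE (2 * r + 5)) := by
  obtain ⟨h1, h2, h3, h4, h5, -⟩ := weights_chain r
  have tA : tableCount (2 * r + 5) (wA (2 * r + 5)) = a (2 * r + 5) := by
    rw [tableCount, if_neg (by omega), if_pos rfl]
  have tB : tableCount (2 * r + 5) (wB (2 * r + 5)) = b (2 * r + 5) := by
    rw [tableCount, if_neg (by omega), if_neg (by omega), if_pos rfl]
  have tC : tableCount (2 * r + 5) (wC (2 * r + 5)) = c (2 * r + 5) := by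
    rw [tableCount, if_neg (by omega), if_neg (by omega), if_neg (by omega), if_pos rfl]
  have tD : tableCount (2 * r + 5) (wD (2 * r + 5)) = d (2 * r + 5) := by
    rw [tableCount, if_neg (by omega), if_neg (by omega), if_neg (by omega), if_neg (by omega),
      if_pos rfl]
  have tE : tableCount (2 * r + 5) (wE (2 * r + 5)) = e (2 * r + 5) := by
    rw [tableCount, if_neg (by omega), if_neg (by omega), if_neg (by omega), if_neg (by omega),
      if_neg (by omega), if_pos rfl]
  rw [weights, Finset.sum_insert, Finset.sum_insert, Finset.sum_insert, Finset.sum_insert,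
    Finset.sum_insert, Finset.sum_singleton, tableCount_zero, tA, tB, tC, tD, tE]
  · ring
  all_goals
    simp only [Finset.mem_insert, Finset.mem_singleton]
    omega

/-- For each of the six values of `k` the numerator vanishes identically as a polynomial in `s = 2 ^
r`. -/
theorem dualCount_eq_zero (r k : ℕ) (hk : 1 ≤ k) (hk6 : k ≤ 6) :
    dualCount (2 * r + 5) k = 0 := by
  obtain ⟨-, h2, h3, h4, h5, h6⟩ := weights_chain r
  have hN : ((2 ^ (2 * r + 5) - 1 : ℕ) : ℚ) = 32 * (2 ^ r) ^ 2 - 1 := by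
    rw [Nat.cast_sub Nat.one_le_two_pow, two_pow_odd]
    push_cast
    ring
  have hs : (2 : ℕ) ^ r ≤ (2 ^ r) ^ 2 := Nat.le_self_pow (by norm_num) _
  have lA : ((wA (2 * r + 5) : ℕ) : ℚ) = 16 * (2 ^ r) ^ 2 - 8 * 2 ^ r := by
    rw [wA_eq, Nat.cast_sub (by omega)]
    push_cast
    ring
  have lB : ((wB (2 * r + 5) : ℕ) : ℚ) = 16 * (2 ^ r) ^ 2 - 4 * 2 ^ r := by
    rw [wB_eq, Nat.cast_sub (by omega)]
    push_cast
    ring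
  have lC : ((wC (2 * r + 5) : ℕ) : ℚ) = 16 * (2 ^ r) ^ 2 := by
    rw [wC_eq]
    push_cast
    ring
  have lD : ((wD (2 * r + 5) : ℕ) : ℚ) = 16 * (2 ^ r) ^ 2 + 4 * 2 ^ r := by
    rw [wD_eq]
    push_cast
    ring
  have lE : ((wE (2 * r + 5) : ℕ) : ℚ) = 16 * (2 ^ r) ^ 2 + 8 * 2 ^ r := by
    rw [wE_eq]
    push_cast
    ring
  rw [dualCount, div_eq_zero_iff]
  left
  -- The binomial is the term of the zero word, so all six terms get the same treatment.
  rw [← U_zero_left, a_eq, b_eq, c_eq, d_eq, e_eq]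
  generalize wA (2 * r + 5) = A at *
  generalize wB (2 * r + 5) = B at *
  generalize wC (2 * r + 5) = W at *
  generalize wD (2 * r + 5) = D at *
  generalize wE (2 * r + 5) = E at *
  generalize 2 ^ (2 * r + 5) - 1 = n at *
  generalize (2 : ℚ) ^ r = s at *
  have l0 : ((0 : ℕ) : ℚ) = 0 := Nat.cast_zero
  interval_cases k
  · rw [U_one_right (Nat.zero_le n), U_one_right (by omega : A ≤ n), U_one_right (by omega : B ≤ n),
      U_one_right (by omega : W ≤ n), U_one_right (by omega : D ≤ n),
      U_one_right (by omega : E ≤ n), lA, lB, lC, lD, lE, hN, l0]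
    ring
  · have f {w : ℕ} (h : w ≤ n) := eq_div_of_mul_eq two_ne_zero ((mul_comm _ _).trans (U_two h))
    rw [f (Nat.zero_le n), f (by omega : A ≤ n), f (by omega : B ≤ n), f (by omega : W ≤ n),
      f (by omega : D ≤ n), f (by omega : E ≤ n), lA, lB, lC, lD, lE, hN, l0]
    ring
  · have f {w : ℕ} (h : w ≤ n) :=
      eq_div_of_mul_eq (by norm_num) ((mul_comm _ _).trans (U_three h))
    rw [f (Nat.zero_le n), f (by omega : A ≤ n), f (by omega : B ≤ n), f (by omega : W ≤ n),
      f (by omega : D ≤ n), f (by omega : E ≤ n), lA, lB, lC, lD, lE, hN, l0]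
    ring
  · have f {w : ℕ} (h : w ≤ n) :=
      eq_div_of_mul_eq (by norm_num) ((mul_comm _ _).trans (U_four h))
    rw [f (Nat.zero_le n), f (by omega : A ≤ n), f (by omega : B ≤ n), f (by omega : W ≤ n),
      f (by omega : D ≤ n), f (by omega : E ≤ n), lA, lB, lC, lD, lE, hN, l0]
    ring
  · have f {w : ℕ} (h : w ≤ n) :=
      eq_div_of_mul_eq (by norm_num) ((mul_comm _ _).trans (U_five h))
    rw [f (Nat.zero_le n), f (by omega : A ≤ n), f (by omega : B ≤ n), f (by omega : W ≤ n),
      f (by omega : D ≤ n), f (by omega : E ≤ n), lA, lB, lC, lD, lE, hN, l0]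
    ring
  · have f {w : ℕ} (h : w ≤ n) :=
      eq_div_of_mul_eq (by norm_num) ((mul_comm _ _).trans (U_six h))
    rw [f (Nat.zero_le n), f (by omega : A ≤ n), f (by omega : B ≤ n), f (by omega : W ≤ n),
      f (by omega : D ≤ n), f (by omega : E ≤ n), lA, lB, lC, lD, lE, hN, l0]
    ring

end FiveWeight

/-! ### Assembly -/

open FiveWeight in
theorem BinaryCode.sum_words_eq {r n : ℕ} (C : BinaryCode n)
    (hC : ∀ w : ℕ, (C.weightCount w : ℚ) = tableCount (2 * r + 5) w)
    (hCS : ∀ c ∈ C, c ≠ 0 → hammingNorm c ∈ weights (2 * r + 5)) (φ : ℕ → ℚ) :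
    ∑ c ∈ C.words, φ (hammingNorm c)
      = φ 0 + a (2 * r + 5) * φ (wA (2 * r + 5)) + b (2 * r + 5) * φ (wB (2 * r + 5))
        + c (2 * r + 5) * φ (wC (2 * r + 5)) + d (2 * r + 5) * φ (wD (2 * r + 5))
        + e (2 * r + 5) * φ (wE (2 * r + 5)) := by
  rw [← sum_tableCount, ← Finset.sum_fiberwise_of_maps_to (g := hammingNorm)
    (t := insert 0 (weights (2 * r + 5)))]
  · refine Finset.sum_congr rfl fun w _ => ?_
    rw [← hC, weightCount_eq_card, ← nsmul_eq_mul, ← Finset.sum_const]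
    exact Finset.sum_congr rfl fun x hx => by rw [(Finset.mem_filter.1 hx).2]
  · intro x hx
    by_cases h0 : x = 0
    · simp [h0]
    · exact Finset.mem_insert_of_mem (hCS x (mem_words.1 hx) h0)

theorem BinaryCode.weightCount_ne_zero {n : ℕ} {C : BinaryCode n} {x : Fin n → ZMod 2}
    (hx : x ∈ C) : C.weightCount (hammingNorm x) ≠ 0 := by
  rw [weightCount_eq_card]
  exact Finset.card_ne_zero_of_mem (Finset.mem_filter.2 ⟨mem_words.2 hx, rfl⟩)

open FiveWeight BinaryCode in
theorem mainTheorem1 (m : ℕ) (hm : 5 ≤ m) (hodd : Odd m) (C : BinaryCode (2 ^ m - 1))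
    (hC : ∀ w : ℕ, (C.weightCount w : ℚ) = FiveWeight.tableCount m w) :
    (∀ k : ℕ, 1 ≤ k → C.weightCount k ≠ 0 →
      2 < k ∧ k < 2 ^ m - 1 ∧
      ∃ lam : ℕ,
        (lam : ℚ) = (k : ℚ) * ((k : ℚ) - 1) * (C.weightCount k : ℚ) /
          (((2 : ℚ) ^ m - 1) * ((2 : ℚ) ^ m - 2)) ∧
        IsTDesign 2 (2 ^ m - 1) k lam (C.supports k)) ∧
    (∀ k : ℕ, 1 ≤ k → C.dual.weightCount k ≠ 0 →
      2 < k ∧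
      ∃ lam : ℕ,
        (lam : ℚ) = (k : ℚ) * ((k : ℚ) - 1) * (C.dual.weightCount k : ℚ) /
          (((2 : ℚ) ^ m - 1) * ((2 : ℚ) ^ m - 2)) ∧
        IsTDesign 2 (2 ^ m - 1) k lam (C.dual.supports k)) ∧
    (∀ k : ℕ, k ≤ 2 ^ m - 1 →
      (C.dual.weightCount k : ℚ) = FiveWeight.dualCount m k) := by
  obtain ⟨r, rfl⟩ : ∃ r, m = 2 * r + 5 := by
    obtain ⟨t, rfl⟩ := hodd
    exact ⟨t - 2, by omega⟩
  have hmem {k : ℕ} (hk : 1 ≤ k) (h : C.weightCount k ≠ 0) : k ∈ weights (2 * r + 5) :=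
    mem_weights_of_tableCount_ne_zero (by omega) (by rw [← hC]; exact_mod_cast h)
  have hCS : ∀ x ∈ C, x ≠ 0 → hammingNorm x ∈ weights (2 * r + 5) := fun x hx h0 =>
    hmem (hammingNorm_pos_iff.2 h0) (weightCount_ne_zero hx)
  -- The dimension is not assumed: the frequencies add up to `2 ^ (3 * m)`.
  have hcard : (C.words.card : ℚ) = 2 ^ (3 * (2 * r + 5)) := by
    have h := sum_words_eq C hC hCS (fun _ => 1)
    simp only [Finset.sum_const, nsmul_eq_mul, mul_one, a_eq, b_eq, c_eq, d_eq, e_eq] at h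
    rw [h]
    ring
  have hdual (k : ℕ) : (C.dual.weightCount k : ℚ) = dualCount (2 * r + 5) k := by
    have h := sum_U_words C k
    rw [sum_words_eq C hC hCS (fun w => U (2 ^ (2 * r + 5) - 1) w k), hcard, U_zero_left] at h
    rw [dualCount, h, mul_div_cancel_left₀ _ (by positivity)]
  have hseven {k : ℕ} (hk : 1 ≤ k) (h : C.dual.weightCount k ≠ 0) : 7 ≤ k := by
    by_contra hlt
    apply h
    have := hdual k
    rw [dualCount_eq_zero r k hk (by omega)] at this
    exact_mod_cast this
  have hd : ∀ y ∈ C.dual, y ≠ 0 → 7 ≤ hammingNorm y := fun y hy h0 =>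
    hseven (hammingNorm_pos_iff.2 h0) (weightCount_ne_zero hy)
  have hn1 : ((2 ^ (2 * r + 5) - 1 : ℕ) : ℚ) = 2 ^ (2 * r + 5) - 1 := by
    rw [Nat.cast_sub Nat.one_le_two_pow]
    push_cast
    rfl
  have hn2 : (2 : ℚ) ^ (2 * r + 5) - 2 = 2 ^ (2 * r + 5) - 1 - 1 := by ring
  refine ⟨fun k hk h => ?_, fun k hk h => ?_, fun k _ => hdual k⟩
  · obtain ⟨h2, hlt⟩ := bounds_of_mem_weights (hmem hk h)
    refine ⟨h2, hlt, ?_⟩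
    rw [hn2, ← hn1]
    exact exists_isTDesign C h2.le hlt.le fun _ _ _ _ hij hij' =>
      pairCount_eq C _ (card_weights_le _) hCS hd k hij hij'
  · have h7 := hseven hk h
    refine ⟨by omega, ?_⟩
    -- No list of dual weights is at hand, so the bound comes from an actual word of weight `k`.
    have hle : k ≤ 2 ^ (2 * r + 5) - 1 := by
      rw [weightCount_eq_card] at h
      obtain ⟨x, hx⟩ := Finset.card_ne_zero.1 h
      rw [← (Finset.mem_filter.1 hx).2]
      exact hammingNorm_le_length x
    rw [hn2, ← hn1]
    exact exists_isTDesign C.dual (by omega) hle fun _ _ _ _ hij hij' =>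
      dual_pairCount_eq C _ (card_weights_le _) hCS hd k hij hij'
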